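/- **Theorem (Orthogonality relations).** Let $0\le M<N$ be integers, and let $$\mathcal S(M,N)=\{S\in \mathrm{Mat}_{N\times N}(\mathbb C)\mid S^2=S,\ S=S^*,\ \operatorname{rank}S=M\},$$ equipped with the normalised $\mathrm U(N)$-invariant measure $\mathrm dS$, that is, the image of the Haar probability measure on $\mathrm U(N)$ under $U\mapsto U I_{M,N}U^*$, where $I_{M,N}$ is the diagonal $N\times N$ matrix whose first $M$ diagonal entries are $1$ and whose other entries are $0$. For $0\le k\le N$ and a permutation $\sigma\in S_k$ of $\{1,\dots,k\}$ define the Weingarten function $$W(\sigma)=\int_{\mathcal S(M,N)} S_{1,\sigma(1)}S_{2,\sigma(2)}\cdots S_{k,\sigma(k)}\,\mathrm dS .$$ For a permutation $\rho\in S_k$ (with $k\ge 1$) that fixes $k$, let $\rho^{\downarrow}\in S_{k-1}$ be the permutation that agrees with $\rho$ on $\{1,\dots,k-1\}$. Then for every $1\le k\le N$ and every $\sigma\in S_k$, $$W(\sigma)=-\frac1N\sum_{i=1}^{k-1}W(\sigma\circ(i\ k))+\delta_{\sigma(k),k}\,\frac MN\,W(\sigma^{\downarrow})+\frac1N\sum_{i=1}^{k-1}\delta_{\sigma(i),k}\,W\big([\sigma\circ(i\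 k)]^{\downarrow}\big).$$ Here permutations are composed from right to left, and a term whose Kronecker delta vanishes is read as $0$. -/

import Mathlib

open MeasureTheory
open scoped Matrix

namespace GrassmannWeingarten

/-- The space `S(M,N)` of `N × N` idempotent Hermitian complex matrices of rank `M`, with the
subspace topology of the space of matrices and the Borel σ-algebra below. -/
def projectionSpace (M N : ℕ) : Set (Matrix (Fin N) (Fin N) ℂ) :=
  {S | S * S = S ∧ Sᴴ = S ∧ S.rank = M}

noncomputable instance instMeasurableSpaceProjectionSpace (M N : ℕ) :
    MeasurableSpace (projectionSpace M N) := borel _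

instance instBorelSpaceProjectionSpace (M N : ℕ) : BorelSpace (projectionSpace M N) := ⟨rfl⟩

noncomputable instance instMeasurableSpaceUnitaryGroup (N : ℕ) :
    MeasurableSpace (Matrix.unitaryGroup (Fin N) ℂ) := borel _

instance instBorelSpaceUnitaryGroup (N : ℕ) :
    BorelSpace (Matrix.unitaryGroup (Fin N) ℂ) := ⟨rfl⟩

instance instCompactSpaceUnitaryGroup (N : ℕ) :
    CompactSpace (Matrix.unitaryGroup (Fin N) ℂ) := by
  have hK : IsCompact (Set.pi Set.univ fun _ : Fin N => Set.pi Set.univ fun _ : Fin N =>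
      Metric.closedBall (0 : ℂ) 1) :=
    isCompact_univ_pi fun _ => isCompact_univ_pi fun _ => isCompact_closedBall _ _
  suffices key : IsCompact
      ((Matrix.unitaryGroup (Fin N) ℂ : Submonoid _) : Set (Matrix (Fin N) (Fin N) ℂ)) from
    isCompact_iff_compactSpace.1 key
  refine IsCompact.of_isClosed_subset hK ?_ ?_
  · have : ((Matrix.unitaryGroup (Fin N) ℂ : Submonoid _) : Set (Matrix (Fin N) (Fin N) ℂ)) =
        {U | star U * U = 1} ∩ {U | U * star U = 1} := by
      ext U
      exact Unitary.mem_iff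
    rw [this]
    exact (isClosed_eq (by fun_prop) (by fun_prop)).inter
      (isClosed_eq (by fun_prop) (by fun_prop))
  · intro U hU i _ j _
    simpa using entry_norm_bound_of_unitary hU i j

/-- The Haar probability measure on the compact group `U(N)`. -/
noncomputable def haarUnitary (N : ℕ) : Measure (Matrix.unitaryGroup (Fin N) ℂ) :=
  Measure.haarMeasure ⊤

/-- The `N × N` matrix `I_{M,N}` whose first `M` diagonal entries are `1` and whose remaining
entries are `0`. -/
def cornerIdentity (M N : ℕ) : Matrix (Fin N) (Fin N) ℂ :=
  Matrix.diagonal fun i => if (i : ℕ) < M then 1 else 0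

theorem cornerIdentity_mem {M N : ℕ} (h : M ≤ N) :
    cornerIdentity M N ∈ projectionSpace M N := by
  refine ⟨?_, ?_, ?_⟩
  · rw [cornerIdentity, Matrix.diagonal_mul_diagonal]
    congr 1
    ext i
    simp
  · rw [cornerIdentity, Matrix.diagonal_conjTranspose]
    congr 1
    ext i
    by_cases hi : (i : ℕ) < M <;> simp [hi]
  · classical
    rw [cornerIdentity, Matrix.rank_diagonal, Fintype.card_subtype]
    simp [Fin.card_filter_val_lt, h]

theorem conj_mem {M N : ℕ} (U : Matrix.unitaryGroup (Fin N) ℂ)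
    {S : Matrix (Fin N) (Fin N) ℂ} (hS : S ∈ projectionSpace M N) :
    (U : Matrix (Fin N) (Fin N) ℂ) * S * (U : Matrix (Fin N) (Fin N) ℂ)ᴴ ∈
      projectionSpace M N := by
  obtain ⟨h1, h2, h3⟩ := hS
  have hU : (U : Matrix (Fin N) (Fin N) ℂ)ᴴ * U = 1 := Unitary.coe_star_mul_self U
  have hU' : (U : Matrix (Fin N) (Fin N) ℂ) * (U : Matrix (Fin N) (Fin N) ℂ)ᴴ = 1 :=
    Unitary.coe_mul_star_self U
  refine ⟨?_, ?_, ?_⟩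
  · calc (U : Matrix (Fin N) (Fin N) ℂ) * S * (U : Matrix (Fin N) (Fin N) ℂ)ᴴ *
          ((U : Matrix (Fin N) (Fin N) ℂ) * S * (U : Matrix (Fin N) (Fin N) ℂ)ᴴ)
        = U * S * ((U : Matrix (Fin N) (Fin N) ℂ)ᴴ * U) * S *
          (U : Matrix (Fin N) (Fin N) ℂ)ᴴ := by simp only [Matrix.mul_assoc]
      _ = U * (S * S) * (U : Matrix (Fin N) (Fin N) ℂ)ᴴ := by
          rw [hU]; simp only [Matrix.mul_assoc, Matrix.one_mul]
      _ = _ := by rw [h1]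
  · simp [Matrix.conjTranspose_mul, h2, Matrix.mul_assoc]
  · have d1 : IsUnit (U : Matrix (Fin N) (Fin N) ℂ).det :=
      Matrix.isUnit_det_of_left_inverse hU
    have d2 : IsUnit ((U : Matrix (Fin N) (Fin N) ℂ)ᴴ).det :=
      Matrix.isUnit_det_of_left_inverse hU'
    rw [Matrix.rank_mul_eq_left_of_isUnit_det _ _ d2, Matrix.rank_mul_eq_right_of_isUnit_det _ _ d1,
      h3]

/-- The action of `U(N)` on `S(M,N)` by conjugation, `(U, S) ↦ U S U^*`. -/
def conj {M N : ℕ} (U : Matrix.unitaryGroup (Fin N) ℂ) (S : projectionSpace M N) :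
    projectionSpace M N :=
  ⟨(U : Matrix (Fin N) (Fin N) ℂ) * S.1 * (U : Matrix (Fin N) (Fin N) ℂ)ᴴ, conj_mem U S.2⟩

/-- The orbit map `U(N) → S(M,N)`, `U ↦ U I_{M,N} U^*`. -/
def orbitMap {M N : ℕ} (h : M ≤ N) (U : Matrix.unitaryGroup (Fin N) ℂ) : projectionSpace M N :=
  conj U ⟨cornerIdentity M N, cornerIdentity_mem h⟩

/-- The normalised `U(N)`-invariant measure `dS` on `S(M,N)`, induced by the Haar measure
of `U(N)`. -/
noncomputable def invariantMeasure {M N : ℕ} (h : M ≤ N) : Measure (projectionSpace M N) :=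
  (haarUnitary N).map (orbitMap h)

/-- The Weingarten function
`W(σ) = ∫ S_{1,σ(1)} S_{2,σ(2)} ⋯ S_{k,σ(k)} dS` of `S(M,N)`, for `σ ∈ S_k` with `k ≤ N`. -/
noncomputable def weingarten {M N k : ℕ} (h : M ≤ N) (hk : k ≤ N)
    (σ : Equiv.Perm (Fin k)) : ℂ :=
  ∫ S : projectionSpace M N, ∏ i : Fin k, S.1 (Fin.castLE hk i) (Fin.castLE hk (σ i))
    ∂(invariantMeasure h)

theorem castSucc_ne_last_of_fix {n : ℕ} {ρ : Equiv.Perm (Fin (n + 1))}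
    (hρ : ρ (Fin.last n) = Fin.last n) (i : Fin n) : ρ i.castSucc ≠ Fin.last n := fun hi =>
  (Fin.castSucc_lt_last i).ne (ρ.injective (hi.trans hρ.symm))

theorem symm_fix {n : ℕ} {ρ : Equiv.Perm (Fin (n + 1))}
    (hρ : ρ (Fin.last n) = Fin.last n) : ρ.symm (Fin.last n) = Fin.last n :=
  (Equiv.symm_apply_eq ρ).2 hρ.symm

/-- For a permutation `ρ ∈ S_{n+1}` that fixes the last element, `ρ^↓ ∈ S_n` is the permutation
that agrees with `ρ` on the first `n` elements. -/
def down {n : ℕ} (ρ : Equiv.Perm (Fin (n + 1))) (hρ : ρ (Fin.last n) = Fin.last n) :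
    Equiv.Perm (Fin n) where
  toFun i := (ρ i.castSucc).castPred (castSucc_ne_last_of_fix hρ i)
  invFun i := (ρ.symm i.castSucc).castPred (castSucc_ne_last_of_fix (symm_fix hρ) i)
  left_inv i := by simp
  right_inv i := by simp

theorem mul_swap_fix {n : ℕ} {σ : Equiv.Perm (Fin (n + 1))} {i : Fin n}
    (h : σ i.castSucc = Fin.last n) :
    (σ * Equiv.swap i.castSucc (Fin.last n)) (Fin.last n) = Fin.last n := by
  simp [h]

end GrassmannWeingarten

namespace GrassmannWeingarten

/-! The recursion is a Schwinger–Dyson (loop) equation. Haar invariance forces the derivative of a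
monomial in the entries of `S`, along `S ↦ exp(tX) S exp(-tX)`, to have mean zero for skew-Hermitian
`X`; this derivative is complex linear in `X`, so matrix units are allowed
(`integral_monomialDeriv`). Take `X = E_{bp}` and the monomial `(∏ S_{r_j c_j}) S_{bl}`, and sum
over `b`. The factor `S_{bl}` yields `N S_{pl}` and, when `l = p`, `-tr S = -M`. Each other factor
yields a term with the columns `c_i` and `l` exchanged and, when `c_i = p`, a term in which `S² = S`
contracts two factors into one. With `p = k`, `r_j = j`, `c_j = σ(j)`, `l = σ(k)`, these are the
terms of the theorem. -/

/-! ### Reduction to Haar integrals over the unitary group -/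

/-- The projection `U I_{M,N} U^*` as a matrix. -/
def orbitMatrix (M : ℕ) {N : ℕ} (U : Matrix.unitaryGroup (Fin N) ℂ) :
    Matrix (Fin N) (Fin N) ℂ :=
  (U : Matrix (Fin N) (Fin N) ℂ) * cornerIdentity M N * (U : Matrix (Fin N) (Fin N) ℂ)ᴴ

theorem continuous_orbitMatrix (M N : ℕ) :
    Continuous (orbitMatrix M : Matrix.unitaryGroup (Fin N) ℂ → _) := by
  unfold orbitMatrix
  fun_prop

@[fun_prop]
theorem continuous_orbitMatrix_apply (M N : ℕ) (i j : Fin N) :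
    Continuous fun U : Matrix.unitaryGroup (Fin N) ℂ => orbitMatrix M U i j :=
  (continuous_orbitMatrix M N).matrix_elem i j

theorem orbitMatrix_mul (M : ℕ) {N : ℕ} (V U : Matrix.unitaryGroup (Fin N) ℂ) :
    orbitMatrix M (V * U) =
      (V : Matrix (Fin N) (Fin N) ℂ) * orbitMatrix M U * (V : Matrix (Fin N) (Fin N) ℂ)ᴴ := by
  simp [orbitMatrix, Matrix.conjTranspose_mul, Matrix.mul_assoc]

theorem orbitMatrix_mul_self {M N : ℕ} (h : M ≤ N) (U : Matrix.unitaryGroup (Fin N) ℂ) :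
    orbitMatrix M U * orbitMatrix M U = orbitMatrix M U :=
  (conj_mem U (cornerIdentity_mem h)).1

theorem trace_orbitMatrix {M N : ℕ} (h : M ≤ N) (U : Matrix.unitaryGroup (Fin N) ℂ) :
    (orbitMatrix M U).trace = M := by
  have hU : (U : Matrix (Fin N) (Fin N) ℂ)ᴴ * U = 1 := Unitary.coe_star_mul_self U
  rw [orbitMatrix, Matrix.trace_mul_comm, ← Matrix.mul_assoc, hU, Matrix.one_mul, cornerIdentity,
    Matrix.trace_diagonal, Finset.sum_boole, Fin.card_filter_val_lt, min_eq_right h]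

instance instIsProbabilityMeasureHaarUnitary (N : ℕ) : IsProbabilityMeasure (haarUnitary N) :=
  ⟨Measure.haarMeasure_self (K₀ := ⊤)⟩

instance instIsMulLeftInvariantHaarUnitary (N : ℕ) : (haarUnitary N).IsMulLeftInvariant :=
  inferInstanceAs (Measure.haarMeasure _).IsMulLeftInvariant

theorem integrable_of_continuous {N : ℕ} {f : Matrix.unitaryGroup (Fin N) ℂ → ℂ}
    (hf : Continuous f) : Integrable f (haarUnitary N) := by
  obtain ⟨C, hC⟩ := isCompact_univ.exists_bound_of_continuousOn hf.continuousOn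
  exact Integrable.of_bound hf.aestronglyMeasurable C (ae_of_all _ fun x => hC x trivial)

theorem weingarten_eq_integral_haar {M N k : ℕ} (h : M ≤ N) (hk : k ≤ N)
    (σ : Equiv.Perm (Fin k)) :
    weingarten h hk σ = ∫ U, ∏ i : Fin k,
      orbitMatrix M U (Fin.castLE hk i) (Fin.castLE hk (σ i)) ∂(haarUnitary N) := by
  have hc : Continuous (orbitMap h : Matrix.unitaryGroup (Fin N) ℂ → projectionSpace M N) :=
    Continuous.subtype_mk (continuous_orbitMatrix M N) _
  have hp : Continuous fun S : projectionSpace M N =>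
      ∏ i : Fin k, S.1 (Fin.castLE hk i) (Fin.castLE hk (σ i)) :=
    continuous_finsetProd _ fun i _ => continuous_subtype_val.matrix_elem _ _
  rw [weingarten, invariantMeasure, integral_map hc.measurable.aemeasurable
    hp.aestronglyMeasurable]
  rfl

/-! ### Infinitesimal unitary invariance -/

open scoped Matrix.Norms.Operator in
theorem hasDerivAt_exp_conj {N : ℕ} {X : Matrix (Fin N) (Fin N) ℂ} (hX : Xᴴ = -X)
    (S : Matrix (Fin N) (Fin N) ℂ) (t : ℝ) (i j : Fin N) :
    HasDerivAt (fun s : ℝ =>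
        (NormedSpace.exp (s • X) * S * (NormedSpace.exp (s • X))ᴴ) i j)
      ((X * (NormedSpace.exp (t • X) * S * (NormedSpace.exp (t • X))ᴴ) -
        (NormedSpace.exp (t • X) * S * (NormedSpace.exp (t • X))ᴴ) * X) i j) t := by
  -- Skewness turns the adjoint into the inverse exponential, so the product rule gives a
  -- commutator.
  have hs : ∀ s : ℝ, (NormedSpace.exp (s • X))ᴴ = NormedSpace.exp (s • -X) := fun s => by
    rw [← Matrix.exp_conjTranspose, Matrix.conjTranspose_smul, hX]
    simp
  simp only [hs]
  have h := ((hasDerivAt_exp_smul_const' X t).mul_const S).mul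
    (hasDerivAt_exp_smul_const (-X) t)
  have h2 := hasDerivAt_pi.1 (hasDerivAt_pi.1 h i) j
  refine h2.congr_deriv ?_
  simp only [Matrix.mul_assoc, Matrix.mul_neg, Matrix.sub_apply, Matrix.add_apply,
    Matrix.neg_apply, sub_eq_add_neg]
  rfl

theorem exp_smul_mem_unitary {N : ℕ} {X : Matrix (Fin N) (Fin N) ℂ} (hX : Xᴴ = -X) (t : ℝ) :
    NormedSpace.exp (t • X) ∈ Matrix.unitaryGroup (Fin N) ℂ := by
  rw [Matrix.mem_unitaryGroup_iff, Matrix.star_eq_conjTranspose, ← Matrix.exp_conjTranspose,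
    Matrix.conjTranspose_smul, hX, star_trivial, smul_neg, Matrix.exp_neg]
  exact Matrix.mul_nonsing_inv _ ((Matrix.isUnit_iff_isUnit_det _).1 (Matrix.isUnit_exp _))

section Loop

variable {ι : Type*} [Fintype ι] [DecidableEq ι] {N : ℕ}

/-- The derivative of `(∏ j, S (r j) (c j)) * S b l` in the direction `X`. -/
def monomialDeriv (r c : ι → Fin N) (b l : Fin N) (S X : Matrix (Fin N) (Fin N) ℂ) : ℂ :=
  (∑ i, (∏ j ∈ Finset.univ.erase i, S (r j) (c j)) * X (r i) (c i)) * S b l +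
    (∏ j, S (r j) (c j)) * X b l

theorem hasDerivAt_monomial (r c : ι → Fin N) (b l : Fin N)
    {γ : ℝ → Matrix (Fin N) (Fin N) ℂ} {γ' : Matrix (Fin N) (Fin N) ℂ} {t : ℝ}
    (h : ∀ i j, HasDerivAt (fun s => γ s i j) (γ' i j) t) :
    HasDerivAt (fun s => (∏ j, γ s (r j) (c j)) * γ s b l) (monomialDeriv r c b l (γ t) γ') t := by
  have := (HasDerivAt.fun_finsetProd (u := Finset.univ) fun i _ => h (r i) (c i)).mul (h b l)
  simpa only [smul_eq_mul] using! this

theorem continuous_monomialDeriv (M : ℕ) (r c : ι → Fin N) (b l : Fin N)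
    (X : Matrix (Fin N) (Fin N) ℂ) :
    Continuous fun U : Matrix.unitaryGroup (Fin N) ℂ =>
      monomialDeriv r c b l (orbitMatrix M U) (X * orbitMatrix M U - orbitMatrix M U * X) := by
  have := continuous_orbitMatrix M N
  have h : ∀ i j, Continuous fun U : Matrix.unitaryGroup (Fin N) ℂ =>
      (X * orbitMatrix M U - orbitMatrix M U * X) i j := fun i j =>
    Continuous.matrix_elem (by fun_prop) i j
  unfold monomialDeriv
  fun_prop

/-- By left invariance the mean of the monomial at `exp(tX) U` does not depend on `t`; differentiate
under the integral at `t = 0`. -/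
theorem integral_monomialDeriv_of_skew (M : ℕ) (r c : ι → Fin N) (b l : Fin N)
    {X : Matrix (Fin N) (Fin N) ℂ} (hX : Xᴴ = -X) :
    ∫ U, monomialDeriv r c b l (orbitMatrix M U) (X * orbitMatrix M U - orbitMatrix M U * X)
      ∂(haarUnitary N) = 0 := by
  let V : ℝ → Matrix.unitaryGroup (Fin N) ℂ := fun t =>
    ⟨NormedSpace.exp (t • X), exp_smul_mem_unitary hX t⟩
  let f : Matrix.unitaryGroup (Fin N) ℂ → ℂ := fun U =>
    (∏ j, orbitMatrix M U (r j) (c j)) * orbitMatrix M U b l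
  let f' : Matrix.unitaryGroup (Fin N) ℂ → ℂ := fun U =>
    monomialDeriv r c b l (orbitMatrix M U) (X * orbitMatrix M U - orbitMatrix M U * X)
  have hf : Continuous f := by fun_prop
  have hf' : Continuous f' := continuous_monomialDeriv M r c b l X
  -- Compactness of the group gives one constant dominating the derivative for all `t`.
  obtain ⟨C, hC⟩ := isCompact_univ.exists_bound_of_continuousOn hf'.continuousOn
  have hderiv : ∀ U t, HasDerivAt (fun s => f (V s * U)) (f' (V t * U)) t := fun U t => by
    simp only [f, f', orbitMatrix_mul]
    exact hasDerivAt_monomial r c b l (hasDerivAt_exp_conj hX (orbitMatrix M U) t)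
  have key := (hasDerivAt_integral_of_dominated_loc_of_deriv_le (μ := haarUnitary N)
    (F := fun t U => f (V t * U)) (F' := fun t U => f' (V t * U)) (x₀ := 0) (s := Set.univ)
    (bound := fun _ => C) Filter.univ_mem
    (Filter.Eventually.of_forall fun t =>
      (hf.comp (continuous_const_mul (V t))).aestronglyMeasurable)
    (integrable_of_continuous (hf.comp (continuous_const_mul (V 0))))
    (hf'.comp (continuous_const_mul (V 0))).aestronglyMeasurable
    (ae_of_all _ fun U t _ => hC _ trivial) (integrable_const C)
    (ae_of_all _ fun U t _ => hderiv U t)).2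
  simp only [integral_mul_left_eq_self] at key
  exact key.unique (hasDerivAt_const _ _)

theorem monomialDeriv_add (r c : ι → Fin N) (b l : Fin N) (S X Y : Matrix (Fin N) (Fin N) ℂ) :
    monomialDeriv r c b l S (X + Y) = monomialDeriv r c b l S X + monomialDeriv r c b l S Y := by
  simp only [monomialDeriv, Matrix.add_apply, mul_add, Finset.sum_add_distrib]
  ring

theorem monomialDeriv_smul (r c : ι → Fin N) (b l : Fin N) (a : ℂ)
    (S X : Matrix (Fin N) (Fin N) ℂ) :
    monomialDeriv r c b l S (a • X) = a * monomialDeriv r c b l S X := by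
  simp only [monomialDeriv, Matrix.smul_apply, smul_eq_mul, mul_left_comm _ a, ← Finset.mul_sum]
  ring

/-- The infinitesimal form of the `U(N)`-invariance, complexified. -/
theorem integral_monomialDeriv (M : ℕ) (r c : ι → Fin N) (b l : Fin N)
    (X : Matrix (Fin N) (Fin N) ℂ) :
    ∫ U, monomialDeriv r c b l (orbitMatrix M U) (X * orbitMatrix M U - orbitMatrix M U * X)
      ∂(haarUnitary N) = 0 := by
  have hA : (X - Xᴴ)ᴴ = -(X - Xᴴ) := by simp
  have hB : (Complex.I • (X + Xᴴ))ᴴ = -(Complex.I • (X + Xᴴ)) := by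
    simp [Matrix.conjTranspose_smul, add_comm]
  -- Every `X` is a complex combination of the skew matrices `X - Xᴴ` and `i(X + Xᴴ)`.
  have hdec : ∀ S : Matrix (Fin N) (Fin N) ℂ, X * S - S * X =
      (1 / 2 : ℂ) • ((X - Xᴴ) * S - S * (X - Xᴴ)) + (-Complex.I / 2) •
        ((Complex.I • (X + Xᴴ)) * S - S * (Complex.I • (X + Xᴴ))) := fun S => by
    simp only [Matrix.smul_mul, Matrix.mul_smul, ← smul_sub, smul_smul]
    have : -Complex.I / 2 * Complex.I = 1 / 2 := by
      rw [div_mul_eq_mul_div, neg_mul, Complex.I_mul_I, neg_neg]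
    rw [this, ← smul_add]
    ext i j
    simp only [Matrix.sub_mul, Matrix.mul_sub, Matrix.add_mul, Matrix.mul_add, Matrix.sub_apply,
      Matrix.add_apply, Matrix.smul_apply, smul_eq_mul]
    ring
  simp_rw [hdec, monomialDeriv_add, monomialDeriv_smul]
  rw [integral_add, integral_const_mul, integral_const_mul,
    integral_monomialDeriv_of_skew M r c b l hA, integral_monomialDeriv_of_skew M r c b l hB]
  · simp
  · exact (integrable_of_continuous (continuous_monomialDeriv M r c b l _)).const_mul _
  · exact (integrable_of_continuous (continuous_monomialDeriv M r c b l _)).const_mul _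

/-! ### The loop equation -/

theorem prod_update_column (r c : ι → Fin N) (l : Fin N) (i : ι)
    (S : Matrix (Fin N) (Fin N) ℂ) :
    ∏ j, S (r j) (Function.update c i l j) =
      (∏ j ∈ Finset.univ.erase i, S (r j) (c j)) * S (r i) l := by
  rw [← Finset.prod_erase_mul _ _ (Finset.mem_univ i), Function.update_self]
  congr 1
  exact Finset.prod_congr rfl fun j hj => by rw [Function.update_of_ne (Finset.ne_of_mem_erase hj)]

theorem sum_monomialDeriv_single (r c : ι → Fin N) (p l : Fin N)
    {S : Matrix (Fin N) (Fin N) ℂ} (hS : S * S = S) :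
    ∑ b, monomialDeriv r c b l S
        (Matrix.single b p 1 * S - S * Matrix.single b p 1) =
      N * ((∏ j, S (r j) (c j)) * S p l)
      - (if l = p then S.trace * ∏ j, S (r j) (c j) else 0)
      + ∑ i, (∏ j, S (r j) (Function.update c i l j)) * S p (c i)
      - ∑ i, (if c i = p then ∏ j, S (r j) (Function.update c i l j) else 0) := by
  -- The only use of idempotency: it collapses the sum over `b` in the contraction terms.
  have hsq : ∀ i, ∑ b, S i b * S b l = S i l := fun i => by
    rw [← Matrix.mul_apply, hS]
  have hE : ∀ b i j : Fin N, (Matrix.single b p 1 * S - S * Matrix.single b p 1 :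
      Matrix (Fin N) (Fin N) ℂ) i j =
      (if i = b then S p j else 0) - (if j = p then S i b else 0) := fun b i j => by
    simp [Matrix.sub_apply, Matrix.mul_apply, Matrix.single_apply, ite_and, eq_comm]
  have h1 : ∀ i, ∑ b, ((∏ j ∈ Finset.univ.erase i, S (r j) (c j)) *
      ((if r i = b then S p (c i) else 0) - (if c i = p then S (r i) b else 0))) * S b l =
      (∏ j, S (r j) (Function.update c i l j)) * S p (c i) -
        (if c i = p then ∏ j, S (r j) (Function.update c i l j) else 0) := fun i => by
    simp only [prod_update_column, mul_assoc, ← Finset.mul_sum, sub_mul, Finset.sum_sub_distrib,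
      ite_mul, zero_mul, Finset.sum_ite_eq, Finset.mem_univ, if_true, mul_sub]
    by_cases h : c i = p <;> simp [h, hsq, mul_comm (S p _)]
  simp only [monomialDeriv, hE, Finset.sum_add_distrib]
  simp only [Finset.sum_mul]
  rw [Finset.sum_comm]
  simp only [h1, Finset.sum_sub_distrib, ← Finset.mul_sum]
  by_cases h : l = p
  · simp [h, Matrix.trace, mul_sub]
    ring
  · simp [h]
    ring

/-- The loop equation for the entries of a random projection. -/
theorem loop_equation {M : ℕ} (h : M ≤ N) (r c : ι → Fin N) (p l : Fin N) :
    N * ∫ U, (∏ j, orbitMatrix M U (r j) (c j)) * orbitMatrix M U p l ∂(haarUnitary N) =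
      -∑ i, ∫ U, (∏ j, orbitMatrix M U (r j) (Function.update c i l j)) *
          orbitMatrix M U p (c i) ∂(haarUnitary N)
      + (if l = p then M * ∫ U, ∏ j, orbitMatrix M U (r j) (c j) ∂(haarUnitary N) else 0)
      + ∑ i, (if c i = p then
          ∫ U, ∏ j, orbitMatrix M U (r j) (Function.update c i l j) ∂(haarUnitary N) else 0) := by
  have h0 : ∫ U, ∑ b, monomialDeriv r c b l (orbitMatrix M U)
      (Matrix.single b p 1 * orbitMatrix M U - orbitMatrix M U * Matrix.single b p 1)
        ∂(haarUnitary N) = 0 := by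
    rw [integral_finsetSum _ fun b _ =>
      integrable_of_continuous (continuous_monomialDeriv M r c b l _)]
    exact Finset.sum_eq_zero fun b _ => integral_monomialDeriv M r c b l _
  simp_rw [sum_monomialDeriv_single r c p l (orbitMatrix_mul_self h _), trace_orbitMatrix h] at h0
  have c1 : Continuous fun U : Matrix.unitaryGroup (Fin N) ℂ =>
      (N : ℂ) * ((∏ j, orbitMatrix M U (r j) (c j)) * orbitMatrix M U p l) := by fun_prop
  have c2 : Continuous fun U : Matrix.unitaryGroup (Fin N) ℂ =>
      if l = p then (M : ℂ) * ∏ j, orbitMatrix M U (r j) (c j) else 0 := by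
    split_ifs <;> fun_prop
  have c3 : ∀ i, Continuous fun U : Matrix.unitaryGroup (Fin N) ℂ =>
      (∏ j, orbitMatrix M U (r j) (Function.update c i l j)) * orbitMatrix M U p (c i) :=
    fun i => by fun_prop
  have c4 : ∀ i, Continuous fun U : Matrix.unitaryGroup (Fin N) ℂ =>
      if c i = p then ∏ j, orbitMatrix M U (r j) (Function.update c i l j) else 0 :=
    fun i => by split_ifs <;> fun_prop
  have c3' := continuous_finsetSum Finset.univ fun i _ => c3 i
  have c4' := continuous_finsetSum Finset.univ fun i _ => c4 i
  rw [integral_sub (integrable_of_continuous ((c1.fun_sub c2).fun_add c3')) (integrable_of_continuous c4'),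
    integral_add (integrable_of_continuous (c1.fun_sub c2)) (integrable_of_continuous c3'),
    integral_sub (integrable_of_continuous c1) (integrable_of_continuous c2),
    integral_finsetSum _ fun i _ => integrable_of_continuous (c3 i),
    integral_finsetSum _ fun i _ => integrable_of_continuous (c4 i), integral_const_mul] at h0
  have e2 : ∫ U, (if l = p then (M : ℂ) * ∏ j, orbitMatrix M U (r j) (c j) else 0)
      ∂(haarUnitary N) =
      if l = p then M * ∫ U, ∏ j, orbitMatrix M U (r j) (c j) ∂(haarUnitary N) else 0 := by
    split_ifs <;> simp [integral_const_mul]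
  have e4 : ∀ i, ∫ U, (if c i = p then ∏ j, orbitMatrix M U (r j) (Function.update c i l j) else 0)
      ∂(haarUnitary N) = if c i = p then
        ∫ U, ∏ j, orbitMatrix M U (r j) (Function.update c i l j) ∂(haarUnitary N) else 0 :=
    fun i => by split_ifs <;> simp
  simp only [e2, e4] at h0
  linear_combination h0

end Loop

/-! ### Specialisation to permutations -/

/-- This identifies the column exchange of the loop equation with `σ ∘ (i k)`. -/
theorem mul_swap_castSucc {n : ℕ} (σ : Equiv.Perm (Fin (n + 1))) (i j : Fin n) :
    (σ * Equiv.swap i.castSucc (Fin.last n)) j.castSucc =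
      Function.update (fun m : Fin n => σ m.castSucc) i (σ (Fin.last n)) j := by
  rw [Equiv.Perm.mul_apply]
  by_cases hj : j = i
  · simp [hj]
  · rw [Function.update_of_ne hj, Equiv.swap_apply_of_ne_of_ne
      (fun h => hj (Fin.castSucc_injective n h)) (Fin.castSucc_lt_last j).ne]

end GrassmannWeingarten

open GrassmannWeingarten in
theorem mainTheorem4 {M N n : ℕ} (hMN : M < N) (hn : n + 1 ≤ N)
    (σ : Equiv.Perm (Fin (n + 1))) :
    GrassmannWeingarten.weingarten hMN.le hn σ =
      -(1 / (N : ℂ)) * ∑ i : Fin n,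
          GrassmannWeingarten.weingarten hMN.le hn
            (σ * Equiv.swap i.castSucc (Fin.last n))
      + (if h : σ (Fin.last n) = Fin.last n then
          ((M : ℂ) / (N : ℂ)) *
            GrassmannWeingarten.weingarten hMN.le (Nat.le_of_succ_le hn)
              (GrassmannWeingarten.down σ h)
        else 0)
      + (1 / (N : ℂ)) * ∑ i : Fin n,
          (if h : σ i.castSucc = Fin.last n then
            GrassmannWeingarten.weingarten hMN.le (Nat.le_of_succ_le hn)
              (GrassmannWeingarten.down (σ * Equiv.swap i.castSucc (Fin.last n))
                (GrassmannWeingarten.mul_swap_fix h))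
          else 0) := by
  have hN : (N : ℂ) ≠ 0 := Nat.cast_ne_zero.2 (by omega)
  have hup : ∀ i j : Fin n, Function.update (fun m : Fin n => Fin.castLE hn (σ m.castSucc)) i
      (Fin.castLE hn (σ (Fin.last n))) j =
      Fin.castLE hn ((σ * Equiv.swap i.castSucc (Fin.last n)) j.castSucc) := fun i j => by
    rw [mul_swap_castSucc]
    exact (Function.apply_update (fun _ => Fin.castLE hn) _ _ _ _).symm
  have hlast : ∀ i : Fin n, σ i.castSucc =
      (σ * Equiv.swap i.castSucc (Fin.last n)) (Fin.last n) := fun i => by simp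
  have key := loop_equation hMN.le (fun j : Fin n => Fin.castLE hn j.castSucc)
    (fun j : Fin n => Fin.castLE hn (σ j.castSucc)) (Fin.castLE hn (Fin.last n))
    (Fin.castLE hn (σ (Fin.last n)))
  have hi : ∀ a b, Fin.castLE hn a = Fin.castLE hn b ↔ a = b := fun a b =>
    (Fin.castLE_injective hn).eq_iff
  simp only [hup, hi] at key
  have e1 : ∀ τ : Equiv.Perm (Fin (n + 1)), weingarten hMN.le hn τ =
      ∫ U, (∏ j : Fin n, orbitMatrix M U (Fin.castLE hn j.castSucc)
        (Fin.castLE hn (τ j.castSucc))) * orbitMatrix M U (Fin.castLE hn (Fin.last n))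
          (Fin.castLE hn (τ (Fin.last n))) ∂(haarUnitary N) := fun τ => by
    simp only [weingarten_eq_integral_haar, Fin.prod_univ_castSucc]
  have e2 : ∀ (τ : Equiv.Perm (Fin (n + 1))) (hτ : τ (Fin.last n) = Fin.last n),
      weingarten hMN.le (Nat.le_of_succ_le hn) (down τ hτ) =
      ∫ U, (∏ j : Fin n, orbitMatrix M U (Fin.castLE hn j.castSucc)
        (Fin.castLE hn (τ j.castSucc))) ∂(haarUnitary N) := fun τ hτ => by
    simp only [weingarten_eq_integral_haar]
    -- The entries of `down τ hτ` and of `τ` have the same underlying value in `Fin N`.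
    rfl
  simp only [e1, e2, dite_eq_ite, ← hlast]
  refine mul_left_cancel₀ hN (key.trans ?_)
  split_ifs <;> field_simp
  ring
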